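/- Let $n\ge 1$, let $M\subset\mathbb R^n$ be compact and convex with Euclidean distance $d$, and let $m$ be a Borel probability measure that is absolutely continuous with respect to Lebesgue measure and has support $M$. For $\psi:M\to\mathbb R$ write $\psi^{\mathfrak c}(x)=-\inf_{y\in M}\left[\tfrac12 d(x,y)^2+\psi(y)\right]$ for $x\in M$; a function $\varphi:M\to\mathbb R$ is called $d^2/2$-convex if $\varphi=\psi^{\mathfrak c}$ for some $\psi:M\to\mathbb R$. A Borel map $g:M\to M$ is called an optimal transport map if it minimizes $h\mapsto\int_M d(x,h(x))^2\,m(dx)$ among all Borel maps $h:M\to M$ with $h_*m=g_*m$. A conjugate measure of a probability measure $\mu$ on $M$ is a measure $\mu^{\mathfrak c}$ such that, for some $d^2/2$-convex function $\varphi$, $\mu=(\mathrm{Id}+\nabla\varphi)_*m$ and $\mu^{\mathfrak c}=(\mathrm{Id}+\nabla\varphi^{\mathfrak c})_*m$, where both gradients exist $m$-almost everywhere. Let $\mu=\lambda\delta_z+(1-\lambda)\nu$ with $\lambda\in[0,1]$, $z\in M$ and $\nu$ a Borel probability measure on $M$. Then an optimal transport map $g$ with $g_*m=\mu$ and a conjugate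 measure $\mu^{\mathfrak c}$ of $\mu$ exist, and there is an open (in $\mathbb R^n$) convex set $U\subset M$ with $m(U)=\lambda$ such that (i) every optimal transport map $g$ with $g_*m=\mu$ satisfies $g=z$ $m$-almost everywhere on $U$; (ii) every conjugate measure $\mu^{\mathfrak c}$ of $\mu$ satisfies $\mu^{\mathfrak c}(U)=0$. -/

import Mathlib

open MeasureTheory

/-- `φ` is the generalized Legendre transform (conjugate) of `ψ` on `M`:
`φ x = - inf_{y ∈ M} [d(x, y)² / 2 + ψ y]` for all `x ∈ M`, where the infimum is a real number.
Only the values of `ψ` and `φ` on `M` matter. -/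
def IsConjugateFunction {X : Type*} [MetricSpace X] (M : Set X) (ψ φ : X → ℝ) : Prop :=
  ∀ x ∈ M, IsGLB ((fun y => dist x y ^ 2 / 2 + ψ y) '' M) (-φ x)

/-- `φ` is `d²/2`-convex on `M`: it is the conjugate of some real function on `M`. -/
def IsSqDistConvex {X : Type*} [MetricSpace X] (M : Set X) (φ : X → ℝ) : Prop :=
  ∃ ψ : X → ℝ, IsConjugateFunction M ψ φ

/-- `g` is a Borel map of `M` into itself that minimizes `h ↦ ∫ d(x, h x)² m(dx)` among all
Borel maps `h` of `M` into itself with `h_* m = g_* m` (here `m` is carried by `M`). -/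
def IsOptimalTransportMap {X : Type*} [MetricSpace X] [MeasurableSpace X]
    (M : Set X) (m : Measure X) (g : X → X) : Prop :=
  Measurable g ∧ Set.MapsTo g M M ∧
    ∀ h : X → X, Measurable h → Set.MapsTo h M M → m.map h = m.map g →
      ∫ x, dist x (g x) ^ 2 ∂m ≤ ∫ x, dist x (h x) ^ 2 ∂m

/-- `g = exp (∇φ)` `m`-almost everywhere on a subset `M` of a Euclidean space, where
`exp_x v = x + v`: for `m`-almost every `x`, the function `φ` (restricted to `M`) is differentiable
at `x` with gradient `g x - x`. -/
def IsExpGradient {n : ℕ} (M : Set (EuclideanSpace ℝ (Fin n)))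
    (m : Measure (EuclideanSpace ℝ (Fin n))) (φ : EuclideanSpace ℝ (Fin n) → ℝ)
    (g : EuclideanSpace ℝ (Fin n) → EuclideanSpace ℝ (Fin n)) : Prop :=
  ∀ᵐ x ∂m, HasGradientWithinAt φ (g x - x) M x

/-- `μc` is the conjugate measure of `μ` (with respect to `m` on `M`): for some `d²/2`-convex
function `φ` with conjugate `φc`, `μ` is the push forward of `m` under `exp (∇φ)` and `μc` is the
push forward of `m` under `exp (∇φc)`. -/
def IsConjugateMeasure {n : ℕ} (M : Set (EuclideanSpace ℝ (Fin n)))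
    (m μ μc : Measure (EuclideanSpace ℝ (Fin n))) : Prop :=
  ∃ (φ φc : EuclideanSpace ℝ (Fin n) → ℝ)
    (g gc : EuclideanSpace ℝ (Fin n) → EuclideanSpace ℝ (Fin n)),
    IsSqDistConvex M φ ∧ IsConjugateFunction M φ φc ∧
    Measurable g ∧ IsExpGradient M m φ g ∧ m.map g = μ ∧
    Measurable gc ∧ IsExpGradient M m φc gc ∧ m.map gc = μc

/-! Adding `‖x‖² / 2` to the potentials turns `d²/2`-conjugation into the Legendre transform
relative to `M`. A mutually conjugate pair `b`, `c` satisfies `⟨x, y⟩ ≤ b x + c y` on `M`, with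
equality exactly when `y` is a subgradient of `b` at `x` relative to `M`. Up to terms depending only
on `m` and `h_* m`, the cost of `h` is twice the integral of the gap `b x + c (h x) - ⟨x, h x⟩ ≥ 0`.
So as soon as one map with image `μ` has zero gap almost everywhere, the optimal maps are exactly
those with zero gap (`IsOptimalTransportMap.fenchel_eq`). Such a map is the gradient of a dual
minimizer (`exists_legendre_potentials`).

Let `C` be the set of points of `M` at which `z` is a subgradient of `b`. It is convex, and almost
all of the preimage of `z` lies in it, so `m C ≥ λ`; an open convex `U ⊆ C` of mass exactly `λ` is
cut out by a ball. Monotonicity of the subdifferential does the rest. An optimal `g` has `⟨g x - z,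
w - x⟩ ≤ 0` for all `w` in the open set `U`, so `g x = z`. If a conjugate map sends `x` into `U`,
the same argument at the image point, with the roles of the two potentials exchanged, forces `x =
z`, a null event. -/

open Set Filter Topology
open scoped BoundedContinuousFunction

/-! ### Legendre conjugacy relative to a set, and subgradients -/

section Legendre

variable {E : Type*} [NormedAddCommGroup E] [InnerProductSpace ℝ E]

/-- `b` is the Legendre transform, relative to `M`, of `a`. -/
def IsLegendreConjugate (M : Set E) (a b : E → ℝ) : Prop :=
  ∀ x ∈ M, IsLUB ((fun y => inner ℝ x y - a y) '' M) (b x)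

theorem dist_sq_div_two_eq (x y : E) :
    dist x y ^ 2 / 2 = ‖x‖ ^ 2 / 2 + ‖y‖ ^ 2 / 2 - inner ℝ x y := by
  rw [dist_eq_norm, norm_sub_sq_real]; ring

theorem isConjugateFunction_iff_isLegendreConjugate {M : Set E} {ψ φ : E → ℝ} :
    IsConjugateFunction M ψ φ ↔
      IsLegendreConjugate M (fun y => ψ y + ‖y‖ ^ 2 / 2) (fun x => φ x + ‖x‖ ^ 2 / 2) := by
  refine forall₂_congr fun x _ => ?_
  simp only [IsGLB, IsLUB, IsGreatest, IsLeast, lowerBounds, upperBounds, mem_ofPred_eq,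
    forall_mem_image, dist_sq_div_two_eq]
  constructor
  · rintro ⟨h₁, h₂⟩
    refine ⟨fun y hy => by linarith [h₁ hy], fun t ht => ?_⟩
    have := @h₂ (‖x‖ ^ 2 / 2 - t) fun y hy => by linarith [ht hy]
    linarith
  · rintro ⟨h₁, h₂⟩
    refine ⟨fun y hy => by linarith [h₁ hy], fun t ht => ?_⟩
    have := @h₂ (‖x‖ ^ 2 / 2 - t) fun y hy => by linarith [ht hy]
    linarith

namespace IsLegendreConjugate

variable {M : Set E} {a b c : E → ℝ}

theorem inner_le (h : IsLegendreConjugate M a b) {x y : E} (hx : x ∈ M) (hy : y ∈ M) :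
    inner ℝ x y ≤ b x + a y := by
  linarith [(h x hx).1 (mem_image_of_mem _ hy)]

theorem le_of_forall (h : IsLegendreConjugate M a b) {x : E} (hx : x ∈ M) {t : ℝ}
    (ht : ∀ y ∈ M, inner ℝ x y - a y ≤ t) : b x ≤ t :=
  (h x hx).2 (forall_mem_image.2 ht)

theorem lipschitzOnWith (h : IsLegendreConjugate M a b) {R : NNReal}
    (hR : ∀ y ∈ M, ‖y‖ ≤ R) : LipschitzOnWith R b M := by
  refine LipschitzOnWith.of_le_add_mul R fun x hx w hw => ?_
  refine h.le_of_forall hx fun y hy => ?_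
  have h₁ := h.inner_le hw hy
  have h₂ : inner ℝ (x - w) y ≤ R * dist x w := by
    rw [dist_eq_norm, mul_comm]
    exact (real_inner_le_norm _ _).trans
      (mul_le_mul_of_nonneg_left (hR y hy) (norm_nonneg _))
  rw [inner_sub_left] at h₂
  linarith

theorem continuousOn (h : IsLegendreConjugate M a b) (hM : Bornology.IsBounded M) :
    ContinuousOn b M := by
  obtain ⟨R, hR₀, hR⟩ := hM.exists_pos_norm_le
  exact (h.lipschitzOnWith (R := ⟨R, hR₀.le⟩) hR).continuousOn

/-- The double transform satisfies `c ≤ a`, so its transform is at least `b`; the Fenchel inequality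
for `b`, `c` gives the reverse bound. -/
theorem biconjugate (h : IsLegendreConjugate M a b) (h' : IsLegendreConjugate M b c) :
    IsLegendreConjugate M c b := by
  refine fun x hx => ⟨forall_mem_image.2 fun y hy => ?_, fun t ht => ?_⟩
  · have := h'.inner_le hy hx
    rw [real_inner_comm] at this
    linarith
  · refine h.le_of_forall hx fun y hy => ?_
    have h₁ : inner ℝ x y - c y ≤ t := ht (mem_image_of_mem _ hy)
    have h₂ : c y ≤ a y := h'.le_of_forall hy fun w hw => by
      have := h.inner_le hw hy
      rw [real_inner_comm] at this
      linarith
    linarith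

theorem convexOn (h : IsLegendreConjugate M a b) (hM : Convex ℝ M) : ConvexOn ℝ M b := by
  refine ⟨hM, fun x hx w hw s t hs ht hst => ?_⟩
  refine h.le_of_forall (hM hx hw hs ht hst) fun y hy => ?_
  have h₁ := mul_le_mul_of_nonneg_left (h.inner_le hx hy) hs
  have h₂ := mul_le_mul_of_nonneg_left (h.inner_le hw hy) ht
  have h₃ : a y = s * a y + t * a y := by rw [← add_mul, hst, one_mul]
  simp only [inner_add_left, real_inner_smul_left, smul_eq_mul]
  linarith

/-- Equality in the Fenchel inequality yields a subgradient. -/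
theorem add_inner_le_of_eq (h : IsLegendreConjugate M a b) {x y : E} (hy : y ∈ M)
    (hxy : b x + a y = inner ℝ x y) {w : E} (hw : w ∈ M) :
    b x + inner ℝ y (w - x) ≤ b w := by
  have := h.inner_le hw hy
  rw [inner_sub_right, real_inner_comm, real_inner_comm x y]
  linarith

/-- A subgradient in `M` yields equality in the Fenchel inequality. -/
theorem eq_of_subgradient (h : IsLegendreConjugate M b c) {x y : E} (hx : x ∈ M) (hy : y ∈ M)
    (hsub : ∀ w ∈ M, b x + inner ℝ y (w - x) ≤ b w) : b x + c y = inner ℝ x y := by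
  refine le_antisymm ?_ ?_
  · have : c y ≤ inner ℝ x y - b x := h.le_of_forall hy fun w hw => by
      have := hsub w hw
      rw [inner_sub_right, real_inner_comm x y] at this
      linarith
    linarith
  · have := h.inner_le hy hx
    rw [real_inner_comm] at this
    linarith

end IsLegendreConjugate

/-- On the segment from `x` to `w` the one-sided derivative at `0` bounds the secant slope from
below, so boundary points of `M` are covered too. -/
theorem ConvexOn.add_inner_le_of_hasGradientWithinAt [CompleteSpace E] {M : Set E} {b : E → ℝ}
    (hb : ConvexOn ℝ M b) {x p : E} (hx : x ∈ M) (hp : HasGradientWithinAt b p M x)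
    {w : E} (hw : w ∈ M) : b x + inner ℝ p (w - x) ≤ b w := by
  have hmaps : MapsTo (AffineMap.lineMap x w : ℝ → E) (Icc 0 1) M := fun t ht =>
    hb.1.segment_subset hx hw (segment_eq_image_lineMap ℝ x w ▸ mem_image_of_mem _ ht)
  have hconv : ConvexOn ℝ (Icc (0 : ℝ) 1) (b ∘ (AffineMap.lineMap x w : ℝ → E)) :=
    (hb.comp_affineMap (AffineMap.lineMap x w)).subset hmaps (convex_Icc 0 1)
  have hd : HasDerivWithinAt (b ∘ (AffineMap.lineMap x w : ℝ → E)) (inner ℝ p (w - x))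
      (Icc 0 1) 0 := by
    have hp' : HasFDerivWithinAt b (InnerProductSpace.toDual ℝ E p) M
        ((AffineMap.lineMap x w : ℝ → E) 0) := by simpa using hp.hasFDerivWithinAt
    simpa using hp'.comp_hasDerivWithinAt (0 : ℝ) AffineMap.hasDerivWithinAt_lineMap hmaps
  have := hconv.le_slope_of_hasDerivWithinAt (y := 1) (by simp) (by simp) one_pos hd
  simp [slope_def_field] at this
  linarith

end Legendre

/-! ### Optimality as complementary slackness, and the choice of `U` -/

section Transport

theorem ContinuousOn.integrable_of_compl_null {X : Type*} [TopologicalSpace X] [MeasurableSpace X]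
    [OpensMeasurableSpace X] [T2Space X] {m : Measure X} [IsFiniteMeasure m]
    {M : Set X} (hMc : IsCompact M) (hm : m Mᶜ = 0) {b : X → ℝ} (hb : ContinuousOn b M) :
    Integrable b m := by
  have := hb.integrableOn_compact (μ := m) hMc
  rwa [IntegrableOn, Measure.restrict_eq_self_of_ae_mem (mem_ae_iff.2 hm)] at this

/-- Testing with `w = x + t v` for small `t > 0` gives `t ‖v‖² ≤ 0`. This is what turns monotonicity
on an open set into an equality of subgradients. -/
theorem eq_zero_of_inner_sub_nonpos {E : Type*} [NormedAddCommGroup E] [InnerProductSpace ℝ E]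
    {U : Set E} (hU : IsOpen U) {x v : E} (hx : x ∈ U)
    (h : ∀ w ∈ U, inner ℝ v (w - x) ≤ 0) : v = 0 := by
  have hlim : Tendsto (fun t : ℝ => x + t • v) (𝓝[>] 0) (𝓝 x) := by
    have : Continuous fun t : ℝ => x + t • v := by fun_prop
    simpa using (this.tendsto 0).mono_left nhdsWithin_le_nhds
  obtain ⟨t, htU, ht⟩ :=
    ((hlim.eventually_mem (hU.mem_nhds hx)).and self_mem_nhdsWithin).exists
  have := h _ htU
  rw [add_sub_cancel_left, real_inner_smul_right, real_inner_self_eq_norm_sq] at this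
  have h' : ‖v‖ ^ 2 ≤ 0 := nonpos_of_mul_nonpos_right this ht
  simpa using le_antisymm h' (sq_nonneg _)

theorem convex_setOf_subgradient {E : Type*} [NormedAddCommGroup E] [InnerProductSpace ℝ E]
    {M : Set E} {b : E → ℝ} (hM : Convex ℝ M) (hb : ConvexOn ℝ M b) (z : E) :
    Convex ℝ {x | x ∈ M ∧ ∀ w ∈ M, b x + inner ℝ z (w - x) ≤ b w} := by
  rintro x ⟨hx, hx'⟩ y ⟨hy, hy'⟩ s t hs ht hst
  refine ⟨hM hx hy hs ht hst, fun w hw => ?_⟩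
  have h₁ := mul_le_mul_of_nonneg_left (hx' w hw) hs
  have h₂ := mul_le_mul_of_nonneg_left (hy' w hw) ht
  have h₃ := hb.2 hx hy hs ht hst
  have h₄ : b w = s * b w + t * b w := by rw [← add_mul, hst, one_mul]
  have h₅ : inner ℝ z w = s * inner ℝ z w + t * inner ℝ z w := by rw [← add_mul, hst, one_mul]
  simp only [inner_sub_right, inner_add_right, real_inner_smul_right, smul_eq_mul] at *
  linarith

theorem map_compl_null {X : Type*} [MeasurableSpace X] {M : Set X} {m : Measure X}
    (hM : MeasurableSet M) (hm : m Mᶜ = 0) {h : X → X} (hh : Measurable h)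
    (hhM : MapsTo h M M) : m.map h Mᶜ = 0 := by
  rw [Measure.map_apply hh hM.compl]
  exact measure_mono_null (fun x hx hxM => hx (hhM hxM)) hm

variable {E : Type*} [NormedAddCommGroup E] [InnerProductSpace ℝ E] [FiniteDimensional ℝ E]
  [MeasurableSpace E] [BorelSpace E] {M : Set E} {m : Measure E} {b c : E → ℝ}

theorem integrable_inner_self_map [IsFiniteMeasure m] (hMc : IsCompact M) (hm : m Mᶜ = 0)
    {h : E → E} (hh : Measurable h) (hhM : MapsTo h M M) :
    Integrable (fun x => inner ℝ x (h x)) m := by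
  obtain ⟨R, hR₀, hR⟩ := hMc.isBounded.exists_pos_norm_le
  refine Integrable.of_bound (measurable_id.inner hh).aestronglyMeasurable (R * R) ?_
  filter_upwards [mem_ae_iff.2 hm] with x hx
  exact (norm_inner_le_norm _ _).trans
    (mul_le_mul (hR x hx) (hR _ (hhM hx)) (norm_nonneg _) hR₀.le)

theorem integrable_fenchel_gap [IsFiniteMeasure m] (hMc : IsCompact M) (hm : m Mᶜ = 0)
    (hb : ContinuousOn b M) (hc : ContinuousOn c M) {h : E → E} (hh : Measurable h)
    (hhM : MapsTo h M M) : Integrable (fun x => b x + c (h x) - inner ℝ x (h x)) m :=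
  ((hb.integrable_of_compl_null hMc hm).add
    ((hc.integrable_of_compl_null hMc
      (map_compl_null hMc.measurableSet hm hh hhM)).comp_measurable hh)).sub
    (integrable_inner_self_map hMc hm hh hhM)

/-- The second bracket depends on `h` only through `m.map h`, so competitors with the same image are
compared by their Fenchel gaps alone. -/
theorem integral_dist_sq_eq [IsFiniteMeasure m] (hMc : IsCompact M) (hm : m Mᶜ = 0)
    (hb : ContinuousOn b M) (hc : ContinuousOn c M) {h : E → E} (hh : Measurable h)
    (hhM : MapsTo h M M) :
    ∫ x, dist x (h x) ^ 2 ∂m = 2 * ∫ x, (b x + c (h x) - inner ℝ x (h x)) ∂m +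
      (∫ x, (‖x‖ ^ 2 - 2 * b x) ∂m + ∫ y, (‖y‖ ^ 2 - 2 * c y) ∂(m.map h)) := by
  have hb' : ContinuousOn (fun x => ‖x‖ ^ 2 - 2 * b x) M := by fun_prop
  have hc' : ContinuousOn (fun x => ‖x‖ ^ 2 - 2 * c x) M := by fun_prop
  have hic := hc'.integrable_of_compl_null hMc (map_compl_null hMc.measurableSet hm hh hhM)
  have hic' : Integrable (fun x => ‖h x‖ ^ 2 - 2 * c (h x)) m := hic.comp_measurable hh
  rw [integral_map hh.aemeasurable hic.aestronglyMeasurable,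
    ← integral_add (hb'.integrable_of_compl_null hMc hm) hic',
    ← integral_const_mul, ← integral_add]
  · refine integral_congr_ae (Eventually.of_forall fun x => ?_)
    have := dist_sq_div_two_eq x (h x)
    simp only
    linarith
  · exact (integrable_fenchel_gap hMc hm hb hc hh hhM).const_mul 2
  · exact (hb'.integrable_of_compl_null hMc hm).add hic'

/-- Complementary slackness is sufficient for optimality. -/
theorem isOptimalTransportMap_of_fenchel_eq [IsFiniteMeasure m] (hMc : IsCompact M) (hm : m Mᶜ = 0)
    (hcb : IsLegendreConjugate M c b) (hbc : IsLegendreConjugate M b c) {g : E → E}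
    (hg : Measurable g) (hgM : MapsTo g M M)
    (heq : ∀ᵐ x ∂m, b x + c (g x) = inner ℝ x (g x)) : IsOptimalTransportMap M m g := by
  have hb := hcb.continuousOn hMc.isBounded
  have hc := hbc.continuousOn hMc.isBounded
  refine ⟨hg, hgM, fun h hh hhM hmap => ?_⟩
  rw [integral_dist_sq_eq hMc hm hb hc hg hgM, integral_dist_sq_eq hMc hm hb hc hh hhM, hmap]
  have h₁ : ∫ x, (b x + c (g x) - inner ℝ x (g x)) ∂m = 0 :=
    integral_eq_zero_of_ae (heq.mono fun x hx => by simp [hx])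
  have h₂ : 0 ≤ ∫ x, (b x + c (h x) - inner ℝ x (h x)) ∂m := by
    refine integral_nonneg_of_ae ?_
    filter_upwards [mem_ae_iff.2 hm] with x hx
    exact sub_nonneg.2 (hcb.inner_le hx (hhM hx))
  linarith

/-- Complementary slackness is necessary for optimality. -/
theorem IsOptimalTransportMap.fenchel_eq [IsFiniteMeasure m] (hMc : IsCompact M) (hm : m Mᶜ = 0)
    (hcb : IsLegendreConjugate M c b) (hbc : IsLegendreConjugate M b c) {g h : E → E}
    (hg : Measurable g) (hgM : MapsTo g M M)
    (heq : ∀ᵐ x ∂m, b x + c (g x) = inner ℝ x (g x)) (hh : IsOptimalTransportMap M m h)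
    (hmap : m.map h = m.map g) : ∀ᵐ x ∂m, b x + c (h x) = inner ℝ x (h x) := by
  have hb := hcb.continuousOn hMc.isBounded
  have hc := hbc.continuousOn hMc.isBounded
  have hle := hh.2.2 g hg hgM hmap.symm
  rw [integral_dist_sq_eq hMc hm hb hc hg hgM,
    integral_dist_sq_eq hMc hm hb hc hh.1 hh.2.1, hmap] at hle
  have h₁ : ∫ x, (b x + c (g x) - inner ℝ x (g x)) ∂m = 0 :=
    integral_eq_zero_of_ae (heq.mono fun x hx => by simp [hx])
  have hnn : 0 ≤ᵐ[m] fun x => b x + c (h x) - inner ℝ x (h x) := by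
    filter_upwards [mem_ae_iff.2 hm] with x hx
    exact sub_nonneg.2 (hcb.inner_le hx (hh.2.1 hx))
  have h₂ : ∫ x, (b x + c (h x) - inner ℝ x (h x)) ∂m = 0 :=
    le_antisymm (by linarith) (integral_nonneg_of_ae hnn)
  have := (integral_eq_zero_iff_of_nonneg_ae hnn
    (integrable_fenchel_gap hMc hm hb hc hh.1 hh.2.1)).1 h₂
  filter_upwards [this] with x hx
  exact sub_eq_zero.1 hx

/-- The frontier of a convex set is null, so the interior of `C` keeps the full mass. Spheres are
null, so the mass of its intersection with a centred ball varies continuously with the radius, and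
the intermediate value theorem applies. -/
theorem Convex.exists_isOpen_convex_measure_eq [Nontrivial E] [IsFiniteMeasure m]
    {ρ : Measure E} [ρ.IsAddHaarMeasure] (hac : m ≪ ρ) {C : Set E} (hC : Convex ℝ C)
    (hCb : Bornology.IsBounded C) {lam : ℝ} (hlam₀ : 0 ≤ lam) (hlam : ENNReal.ofReal lam ≤ m C) :
    ∃ U, IsOpen U ∧ Convex ℝ U ∧ U ⊆ C ∧ m U = ENNReal.ofReal lam := by
  have hI : ENNReal.ofReal lam ≤ m (interior C) := by
    refine hlam.trans ((measure_mono subset_closure).trans ?_)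
    rw [closure_eq_interior_union_frontier]
    refine (measure_union_le _ _).trans ?_
    rw [hac (hC.addHaar_frontier _), add_zero]
  obtain ⟨R, hR₀, hR⟩ := hCb.exists_pos_norm_le
  have hna : NullSingletonClass ((m.restrict (interior C)).map norm) := ⟨fun r => by
    rw [Measure.map_apply measurable_norm (measurableSet_singleton r)]
    refine Measure.absolutelyContinuous_of_le Measure.restrict_le_self (hac ?_)
    have : (norm ⁻¹' {r} : Set E) = Metric.sphere 0 r := by ext; simp
    rw [this, Measure.addHaar_sphere]⟩
  set κ := (m.restrict (interior C)).map norm with hκ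
  -- The interval `(0, r]` of norms differs from the open ball only by the sphere and the origin,
  -- both null.
  have hball : ∀ r, 0 ≤ r → κ (Ioc 0 r) = m (interior C ∩ Metric.ball 0 r) := fun r hr => by
    rw [← Ioo_ae_eq_Ioc.measure_eq, hκ, Measure.map_apply measurable_norm measurableSet_Ioo,
      Measure.restrict_apply (measurable_norm measurableSet_Ioo), inter_comm]
    refine le_antisymm (measure_mono fun x hx => ⟨hx.1, by simpa using hx.2.2⟩) ?_
    have hsub : interior C ∩ Metric.ball 0 r ⊆
        (interior C ∩ norm ⁻¹' Ioo 0 r) ∪ {0} := fun x hx => by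
      by_cases h0 : x = 0
      · exact Or.inr h0
      · exact Or.inl ⟨hx.1, norm_pos_iff.2 h0, by simpa using hx.2⟩
    refine (measure_mono hsub).trans ((measure_union_le _ _).trans ?_)
    rw [hac (measure_singleton 0), add_zero]
  have hcont : Continuous fun r => ∫ _ in (0 : ℝ)..r, (1 : ℝ) ∂κ :=
    intervalIntegral.continuous_primitive (fun _ _ => intervalIntegrable_const) 0
  have hval : ∀ r, 0 ≤ r → ∫ _ in (0 : ℝ)..r, (1 : ℝ) ∂κ = m.real (interior C ∩ Metric.ball 0 r) :=
    fun r hr => by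
      rw [intervalIntegral.integral_of_le hr]
      simp [Measure.real, hball r hr]
  have hfull : interior C ∩ Metric.ball 0 (R + 1) = interior C :=
    inter_eq_left.2 fun x hx => by
      have := hR x (interior_subset hx)
      simp; linarith
  have hmem : lam ∈ Icc (∫ _ in (0 : ℝ)..0, (1 : ℝ) ∂κ) (∫ _ in (0 : ℝ)..(R + 1), (1 : ℝ) ∂κ) := by
    refine ⟨by simpa using hlam₀, ?_⟩
    rw [hval _ (by positivity), hfull]
    exact (ENNReal.ofReal_le_iff_le_toReal (measure_ne_top _ _)).1 hI
  obtain ⟨r, hr, hrl⟩ := intermediate_value_Icc (by positivity : (0 : ℝ) ≤ R + 1)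
    hcont.continuousOn hmem
  refine ⟨interior C ∩ Metric.ball 0 r, isOpen_interior.inter Metric.isOpen_ball,
    hC.interior.inter (convex_ball 0 r), inter_subset_left.trans interior_subset, ?_⟩
  rw [← hrl]
  simp only
  rw [hval r hr.1, Measure.real, ENNReal.ofReal_toReal (measure_ne_top _ _)]

end Transport

/-! ### The Legendre transform of a continuous function on a compact set -/

section Legendre

variable {E : Type*} [NormedAddCommGroup E] [InnerProductSpace ℝ E] {M : Set E}

/-- The Legendre transform of a function defined on `M`. -/
noncomputable def legendre (M : Set E) (a : M → ℝ) (x : E) : ℝ :=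
  ⨆ y : M, (inner ℝ x (y : E) - a y)

variable [CompactSpace M] {a : M → ℝ}

theorem le_legendre (ha : Continuous a) (x : E) (y : M) :
    inner ℝ x (y : E) - a y ≤ legendre M a x :=
  le_ciSup (f := fun y : M => inner ℝ x (y : E) - a y)
    (isCompact_range (by fun_prop)).bddAbove y

theorem exists_legendre_eq [Nonempty M] (ha : Continuous a) (x : E) :
    ∃ y : M, legendre M a x = inner ℝ x (y : E) - a y := by
  have hcont : Continuous fun y : M => inner ℝ x (y : E) - a y := by fun_prop
  obtain ⟨y, -, hy⟩ := isCompact_univ.exists_isMaxOn univ_nonempty hcont.continuousOn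
  exact ⟨y, le_antisymm (ciSup_le fun w => hy (mem_univ w)) (le_legendre ha x y)⟩

theorem legendre_le_add [Nonempty M] (ha : Continuous a) {a' : M → ℝ} {x : E} {t : ℝ}
    (h : ∀ y, a y ≤ a' y + t) : legendre M a' x ≤ legendre M a x + t :=
  ciSup_le fun y => by linarith [h y, le_legendre ha x y]

theorem lipschitzWith_legendre [Nonempty M] (ha : Continuous a) {R : NNReal}
    (hR : ∀ y ∈ M, ‖y‖ ≤ R) : LipschitzWith R (legendre M a) := by
  refine LipschitzWith.of_le_add_mul R fun x w => ciSup_le fun y => ?_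
  have h₁ := le_legendre ha w y
  have h₂ : inner ℝ (x - w) (y : E) ≤ R * dist x w := by
    rw [dist_eq_norm, mul_comm]
    exact (real_inner_le_norm _ _).trans
      (mul_le_mul_of_nonneg_left (hR y y.2) (norm_nonneg _))
  rw [inner_sub_left] at h₂
  linarith

theorem continuous_legendre [Nonempty M] (ha : Continuous a) : Continuous (legendre M a) := by
  obtain ⟨R, hR₀, hR⟩ :=
    (isCompact_iff_compactSpace.2 ‹CompactSpace M›).isBounded.exists_pos_norm_le
  exact (lipschitzWith_legendre (R := ⟨R, hR₀.le⟩) ha hR).continuous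

theorem isLUB_legendre [Nonempty M] (ha : Continuous a) (x : E) :
    IsLUB (range fun y : M => inner ℝ x (y : E) - a y) (legendre M a x) :=
  isLUB_ciSup (isCompact_range (by fun_prop)).bddAbove

theorem isLegendreConjugate_legendre [Nonempty M] {a : E → ℝ} (ha : ContinuousOn a M) :
    IsLegendreConjugate M a (legendre M fun y => a y) := fun x _ => by
  have := isLUB_legendre (M := M) (a := fun y => a y) ha.domRestrict x
  rwa [image_eq_range]

theorem legendre_add_inner_le (ha : Continuous a) {x : E} {y : M}
    (hy : legendre M a x = inner ℝ x (y : E) - a y) (w : E) :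
    legendre M a x + inner ℝ (y : E) (w - x) ≤ legendre M a w := by
  have := le_legendre ha w y
  rw [hy, inner_sub_right]
  linarith [real_inner_comm w (y : E), real_inner_comm x (y : E)]

/-- A maximizer `y` gives an affine minorant of slope `y` touching at `x`. Hence differentiability
at `x` makes the maximizer unique. -/
theorem gradient_legendre_eq [CompleteSpace E] (ha : Continuous a) {x : E} {y : M}
    (hy : legendre M a x = inner ℝ x (y : E) - a y)
    (hd : DifferentiableAt ℝ (legendre M a) x) : gradient (legendre M a) x = y := by
  have hmin : IsLocalMin (fun w => legendre M a w - innerSL ℝ (y : E) w) x :=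
    Eventually.of_forall fun w => by
      have := legendre_add_inner_le ha hy w
      rw [inner_sub_right] at this
      simp only [innerSL_apply_apply]
      linarith
  have hzero := hmin.hasFDerivAt_eq_zero
    (hd.hasGradientAt.hasFDerivAt.sub (innerSL ℝ (y : E)).hasFDerivAt)
  refine (InnerProductSpace.toDual ℝ E).injective ?_
  rw [sub_eq_zero.1 hzero]
  ext w
  simp

end Legendre

/-! ### Almost everywhere differentiability (Rademacher) -/

section Gradient

variable {E : Type*} [NormedAddCommGroup E] [InnerProductSpace ℝ E] [FiniteDimensional ℝ E]
  [MeasurableSpace E] [BorelSpace E]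

theorem measurable_gradient (f : E → ℝ) : Measurable (gradient f) := by
  have : CompleteSpace E := FiniteDimensional.complete ℝ E
  exact (InnerProductSpace.toDual ℝ E).symm.continuous.measurable.comp (measurable_fderiv ℝ f)

variable {M : Set E} [CompactSpace M] [Nonempty M] {a : M → ℝ}
  {m ρ : Measure E} [ρ.IsAddHaarMeasure]

theorem ae_differentiableAt_legendre (hac : m ≪ ρ)
    (ha : Continuous a) : ∀ᵐ x ∂m, DifferentiableAt ℝ (legendre M a) x := by
  obtain ⟨R, hR₀, hR⟩ :=
    (isCompact_iff_compactSpace.2 ‹CompactSpace M›).isBounded.exists_pos_norm_le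
  exact hac.ae_le (lipschitzWith_legendre (R := ⟨R, hR₀.le⟩) ha hR).ae_differentiableAt

end Gradient

/-! ### The dual Kantorovich problem and its first variation -/

section Dual

theorem isCompact_setOf_lipschitzWith {X : Type*} [PseudoMetricSpace X] [CompactSpace X]
    (z : X) (R : NNReal) :
    IsCompact {a : X →ᵇ ℝ | LipschitzWith R a ∧ a z = 0} := by
  refine BoundedContinuousFunction.arzela_ascoli₂
    (Metric.closedBall 0 (R * Metric.diam (univ : Set X))) (isCompact_closedBall _ _) _ ?_ ?_ ?_
  · have h : {a : X →ᵇ ℝ | LipschitzWith R a ∧ a z = 0} =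
        (⋂ x, ⋂ y, {a | dist (a x) (a y) ≤ R * dist x y}) ∩ {a | a z = 0} := by
      ext a; simp [lipschitzWith_iff_dist_le_mul]
    rw [h]
    have hev : ∀ x : X, Continuous fun a : X →ᵇ ℝ => a x :=
      fun x => continuous_eval_const x
    refine (isClosed_iInter fun x => isClosed_iInter fun y => ?_).inter ?_
    · exact isClosed_le ((hev x).dist (hev y)) continuous_const
    · exact isClosed_eq (hev z) continuous_const
  · rintro a x ⟨ha, hz⟩
    rw [mem_closedBall_iff_norm, sub_zero, ← sub_zero (a x), ← hz, ← dist_eq_norm]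
    refine (ha.dist_le_mul x z).trans (mul_le_mul_of_nonneg_left ?_ R.2)
    exact Metric.dist_le_diam_of_mem isCompact_univ.isBounded (mem_univ _) (mem_univ _)
  · exact (LipschitzWith.uniformEquicontinuous _ R fun a => a.2.1).equicontinuous

theorem integrable_legendre {E : Type*} [NormedAddCommGroup E] [InnerProductSpace ℝ E]
    [MeasurableSpace E] [BorelSpace E] {M : Set E} [CompactSpace M] [Nonempty M]
    {m : Measure E} [IsFiniteMeasure m] (hm : m Mᶜ = 0) {a : M → ℝ} (ha : Continuous a) :
    Integrable (legendre M a) m :=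
  (continuous_legendre ha).continuousOn.integrable_of_compl_null
    (isCompact_iff_compactSpace.2 ‹CompactSpace M›) hm

/-- The derivative of the Legendre transform in the direction of a perturbation, at a point where
the maximizer is unique. -/
theorem tendsto_legendre_slope {E : Type*} [NormedAddCommGroup E] [InnerProductSpace ℝ E]
    {M : Set E} [CompactSpace M] [Nonempty M] (a u : M →ᵇ ℝ) {x : E} {y₀ : M}
    (huniq : ∀ y : M, legendre M a x = inner ℝ x (y : E) - a y → y = y₀)
    (hy₀ : legendre M a x = inner ℝ x (y₀ : E) - a y₀) {t : ℕ → ℝ} (ht : ∀ k, 0 < t k)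
    (htlim : Tendsto t atTop (𝓝 0)) :
    Tendsto (fun k => (legendre M ⇑(a + t k • u) x - legendre M a x) / t k) atTop
      (𝓝 (-u y₀)) := by
  have hmax : ∀ k, ∃ y : M, legendre M ⇑(a + t k • u) x = inner ℝ x (y : E) - (a y + t k * u y) :=
    fun k => exists_legendre_eq (a + t k • u).continuous x
  choose y hy using hmax
  have hcont : Continuous fun w : M => inner ℝ x (w : E) - a w := by
    have := a.continuous
    fun_prop
  -- By compactness it suffices that every cluster point of the perturbed maximizers maximizes the
  -- unperturbed problem.
  have hylim : Tendsto y atTop (𝓝 y₀) := by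
    refine isCompact_univ.tendsto_nhds_of_unique_mapClusterPt
      (Eventually.of_forall fun _ => mem_univ _) fun y' _ hy' => huniq y' ?_
    refine le_antisymm ?_ (le_legendre a.continuous x y')
    have hlow : ∀ k, legendre M a x - 2 * t k * ‖u‖ ≤ inner ℝ x (y k : E) - a (y k) := fun k => by
      have h₁ : inner ℝ x (y₀ : E) - (a y₀ + t k * u y₀) ≤ legendre M ⇑(a + t k • u) x :=
        le_legendre (a + t k • u).continuous x y₀
      have hk := hy k
      have h₂ := mul_le_mul_of_nonneg_left (abs_le.1 (u.norm_coe_le_norm y₀)).2 (ht k).le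
      have h₃ := mul_le_mul_of_nonneg_left (abs_le.1 (u.norm_coe_le_norm (y k))).1 (ht k).le
      linarith
    have hlim : Tendsto ((fun w : M => inner ℝ x (w : E) - a w) ∘ y) atTop
        (𝓝 (legendre M a x)) := by
      refine tendsto_of_tendsto_of_tendsto_of_le_of_le ?_ tendsto_const_nhds hlow
        fun k => le_legendre a.continuous x (y k)
      simpa using tendsto_const_nhds.sub ((htlim.const_mul 2).mul_const ‖u‖)
    have hmc := hy'.continuousAt_comp hcont.continuousAt
    have hcl : ClusterPt (inner ℝ x (y' : E) - a y') (𝓝 (legendre M a x)) :=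
      ClusterPt.mono hmc hlim
    exact (eq_of_nhds_neBot hcl).ge
  refine tendsto_of_tendsto_of_tendsto_of_le_of_le tendsto_const_nhds
    ((u.continuous.tendsto _).comp hylim).neg (fun k => ?_) fun k => ?_
  · have h : inner ℝ x (y₀ : E) - (a y₀ + t k * u y₀) ≤ legendre M ⇑(a + t k • u) x :=
      le_legendre (a + t k • u).continuous x y₀
    rw [le_div_iff₀ (ht k)]
    linarith
  · have h := le_legendre a.continuous x (y k)
    have hk := hy k
    rw [div_le_iff₀ (ht k)]
    simp only [Function.comp_apply]
    linarith

variable {E : Type*} [NormedAddCommGroup E] [InnerProductSpace ℝ E]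
  [MeasurableSpace E] [BorelSpace E] {M : Set E} [CompactSpace M] [Nonempty M]
  {m : Measure E} [IsProbabilityMeasure m] {κ : Measure M} [IsProbabilityMeasure κ]

/-- The objective function of the dual Kantorovich problem. -/
noncomputable def dualObjective (m : Measure E) (κ : Measure M) (a : M →ᵇ ℝ) : ℝ :=
  ∫ x, legendre M a x ∂m + ∫ y, a y ∂κ

theorem dualObjective_le_add (hm : m Mᶜ = 0) (a a' : M →ᵇ ℝ) :
    dualObjective m κ a ≤ dualObjective m κ a' + 2 * dist a a' := by
  have h₁ : ∫ x, legendre M a x ∂m ≤ ∫ x, (legendre M a' x + dist a a') ∂m := by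
    refine integral_mono (integrable_legendre hm a.continuous)
      ((integrable_legendre hm a'.continuous).add (integrable_const _)) fun x => ?_
    refine legendre_le_add a'.continuous fun y => ?_
    have := (abs_le.1 (Real.dist_eq (a y) (a' y) ▸ a.dist_coe_le_dist (g := a') y)).1
    linarith
  have h₂ : ∫ y, a y ∂κ ≤ ∫ y, (a' y + dist a a') ∂κ := by
    refine integral_mono (a.integrable κ) ((a'.integrable κ).add (integrable_const _)) fun y => ?_
    have := (abs_le.1 (Real.dist_eq (a y) (a' y) ▸ a.dist_coe_le_dist (g := a') y)).2
    simp only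
    linarith
  rw [integral_add (integrable_legendre hm a'.continuous) (integrable_const _)] at h₁
  rw [integral_add (a'.integrable κ) (integrable_const _)] at h₂
  simp only [integral_const, probReal_univ, one_smul] at h₁ h₂
  unfold dualObjective
  linarith

theorem continuous_dualObjective (hm : m Mᶜ = 0) : Continuous (dualObjective m κ) :=
  (LipschitzWith.of_le_add_mul 2 fun a a' => by
    simpa using dualObjective_le_add (κ := κ) hm a a').continuous

/-- Passing to the double Legendre transform and normalizing at a point does not increase the
dual objective. -/
theorem exists_lipschitzWith_dualObjective_le (hm : m Mᶜ = 0) (z : M) {R : NNReal}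
    (hR : ∀ y ∈ M, ‖y‖ ≤ R) (a : M →ᵇ ℝ) :
    ∃ a' : M →ᵇ ℝ, (LipschitzWith R a' ∧ a' z = 0) ∧
      dualObjective m κ a' ≤ dualObjective m κ a := by
  have hB : Continuous fun x : M => legendre M a x :=
    (continuous_legendre a.continuous).comp continuous_subtype_val
  -- The double transform is Lipschitz and at most `a`. Subtracting `k` raises its transform by `k`,
  -- which cancels in the objective because both measures have mass one.
  set d : M → ℝ := fun y => legendre M (fun x : M => legendre M a x) y with hd
  have hdL : LipschitzWith R d := by
    have := (lipschitzWith_legendre hB hR).comp (LipschitzWith.subtype_val M)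
    rwa [mul_one] at this
  set k := d z
  have ha'c : Continuous fun y => d y - k := hdL.continuous.sub continuous_const
  refine ⟨BoundedContinuousFunction.mkOfCompact ⟨fun y => d y - k, ha'c⟩, ⟨?_, ?_⟩, ?_⟩
  · have := hdL.sub (LipschitzWith.const k)
    rwa [add_zero] at this
  · simp [k]
  · have hda : ∀ y, d y ≤ a y := fun y => ciSup_le fun x => by
      have := le_legendre a.continuous (x : E) y
      rw [real_inner_comm]
      linarith
    have h₁ : ∫ x, legendre M (fun y => d y - k) x ∂m ≤ ∫ x, (legendre M a x + k) ∂m := by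
      refine integral_mono_ae (integrable_legendre hm ha'c)
        ((integrable_legendre hm a.continuous).add (integrable_const _)) ?_
      filter_upwards [mem_ae_iff.2 hm] with x hx
      refine ciSup_le fun y => ?_
      have := le_legendre hB (y : E) ⟨x, hx⟩
      simp only [hd]
      rw [real_inner_comm] at this
      linarith
    have hdi : Integrable d κ :=
      (BoundedContinuousFunction.mkOfCompact ⟨d, hdL.continuous⟩).integrable κ
    have h₂ : ∫ y, d y ∂κ ≤ ∫ y, a y ∂κ := integral_mono hdi (a.integrable κ) hda
    rw [integral_add (integrable_legendre hm a.continuous) (integrable_const _)] at h₁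
    have h₃ : ∫ y, (d y - k) ∂κ = ∫ y, d y ∂κ - k := by
      rw [integral_sub hdi (integrable_const _)]; simp
    simp only [integral_const, probReal_univ, one_smul] at h₁
    change ∫ x, legendre M (fun y => d y - k) x ∂m + ∫ y, (d y - k) ∂κ ≤
      ∫ x, legendre M a x ∂m + ∫ y, a y ∂κ
    linarith

theorem exists_dualObjective_minimizer (hm : m Mᶜ = 0) :
    ∃ a : M →ᵇ ℝ, ∀ a', dualObjective m κ a ≤ dualObjective m κ a' := by
  obtain ⟨R, hR₀, hR⟩ :=
    (isCompact_iff_compactSpace.2 ‹CompactSpace M›).isBounded.exists_pos_norm_le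
  obtain ⟨z⟩ := ‹Nonempty M›
  obtain ⟨a, -, ha⟩ := (isCompact_setOf_lipschitzWith z ⟨R, hR₀.le⟩).exists_isMinOn
    ⟨0, LipschitzWith.const' (0 : ℝ), rfl⟩
    (continuous_dualObjective (κ := κ) hm).continuousOn
  refine ⟨a, fun a' => ?_⟩
  obtain ⟨a₁, h₁, h₂⟩ := exists_lipschitzWith_dualObjective_le (κ := κ) hm z
    (R := ⟨R, hR₀.le⟩) hR a'
  exact (ha h₁).trans h₂

variable [FiniteDimensional ℝ E] {ρ : Measure E} [ρ.IsAddHaarMeasure]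

/-- The gradient of the Legendre transform of a dual minimizer transports `m` to `κ`. -/
theorem map_gradient_legendre_of_minimizer (hac : m ≪ ρ)
    (hm : m Mᶜ = 0) {a : M →ᵇ ℝ} (ha : ∀ a', dualObjective m κ a ≤ dualObjective m κ a') :
    m.map (gradient (legendre M a)) = κ.map Subtype.val := by
  have hT := measurable_gradient (legendre M a)
  -- Minimality along `a + t u` bounds the difference quotients below by `-∫ u dκ`, and as `t → 0`
  -- they tend to `-f` at the gradient. Applying this to `-f` as well gives equality.
  have hkey : ∀ f : E →ᵇ ℝ,
      ∫ x, f (gradient (legendre M a) x) ∂m ≤ ∫ y, f (y : E) ∂κ := fun f => by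
    set u : M →ᵇ ℝ := f.compContinuous ⟨Subtype.val, continuous_subtype_val⟩
    set t : ℕ → ℝ := fun k => 1 / ((k : ℝ) + 1)
    have ht : ∀ k, 0 < t k := fun k => by positivity
    set q : ℕ → E → ℝ := fun k x => (legendre M ⇑(a + t k • u) x - legendre M a x) / t k with hq
    have hint : ∀ k, Integrable (q k) m := fun k =>
      ((integrable_legendre hm (a + t k • u).continuous).sub
        (integrable_legendre hm a.continuous)).div_const _
    have hlow : ∀ k, -∫ y, u y ∂κ ≤ ∫ x, q k x ∂m := fun k => by
      have h := ha (a + t k • u)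
      have h₁ : ∫ y, (a + t k • u) y ∂κ = ∫ y, a y ∂κ + t k * ∫ y, u y ∂κ := by
        rw [← integral_const_mul, ← integral_add (a.integrable κ) ((u.integrable κ).const_mul _)]
        rfl
      rw [dualObjective, dualObjective, h₁] at h
      simp only [hq]
      rw [integral_div, integral_sub (integrable_legendre hm (a + t k • u).continuous)
        (integrable_legendre hm a.continuous), le_div_iff₀ (ht k)]
      linarith
    have hlim : Tendsto (fun k => ∫ x, q k x ∂m) atTop
        (𝓝 (∫ x, -f (gradient (legendre M a) x) ∂m)) := by
      refine tendsto_integral_of_dominated_convergence (fun _ => ‖u‖)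
        (fun k => (hint k).aestronglyMeasurable) (integrable_const _) (fun k => ?_) ?_
      · refine Eventually.of_forall fun x => ?_
        have hu : ∀ y, |t k * u y| ≤ t k * ‖u‖ := fun y => by
          rw [abs_mul, abs_of_pos (ht k)]
          exact mul_le_mul_of_nonneg_left (u.norm_coe_le_norm y) (ht k).le
        have h₁ : legendre M ⇑(a + t k • u) x ≤ legendre M a x + t k * ‖u‖ :=
          legendre_le_add a.continuous fun y => by
            change a y ≤ a y + t k * u y + t k * ‖u‖
            linarith [(abs_le.1 (hu y)).1]
        have h₂ : legendre M a x ≤ legendre M ⇑(a + t k • u) x + t k * ‖u‖ :=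
          legendre_le_add (a + t k • u).continuous fun y => by
            change a y + t k * u y ≤ a y + t k * ‖u‖
            linarith [(abs_le.1 (hu y)).2]
        simp only [hq]
        rw [norm_div, Real.norm_of_nonneg (ht k).le, div_le_iff₀ (ht k), Real.norm_eq_abs, abs_le]
        constructor <;> linarith
      · filter_upwards [ae_differentiableAt_legendre hac a.continuous] with x hx
        obtain ⟨y₀, hy₀⟩ := exists_legendre_eq a.continuous x
        have hg := gradient_legendre_eq a.continuous hy₀ hx
        rw [hg]
        exact tendsto_legendre_slope a u
          (fun y hy => Subtype.ext ((gradient_legendre_eq a.continuous hy hx).symm.trans hg))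
          hy₀ ht tendsto_one_div_add_atTop_nhds_zero_nat
    have h := ge_of_tendsto' hlim hlow
    rw [integral_neg, neg_le_neg_iff] at h
    exact h
  have := Measure.isProbabilityMeasure_map (μ := m) hT.aemeasurable
  have := Measure.isProbabilityMeasure_map (μ := κ) measurable_subtype_coe.aemeasurable
  refine ext_of_forall_integral_eq_of_IsFiniteMeasure fun f => ?_
  rw [integral_map hT.aemeasurable f.continuous.aestronglyMeasurable,
    integral_map measurable_subtype_coe.aemeasurable f.continuous.aestronglyMeasurable]
  refine le_antisymm (hkey f) ?_
  have h := hkey (-f)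
  simp only [BoundedContinuousFunction.coe_neg, Pi.neg_apply, integral_neg, neg_le_neg_iff] at h
  exact h

end Dual

/-! ### Gradients under the quadratic shift -/

section Gradient

variable {E : Type*} [NormedAddCommGroup E] [InnerProductSpace ℝ E] [CompleteSpace E]

theorem hasGradientWithinAt_add_norm_sq_div_two_iff {M : Set E} {φ : E → ℝ} {p x : E} :
    HasGradientWithinAt (fun y => φ y + ‖y‖ ^ 2 / 2) p M x ↔
      HasGradientWithinAt φ (p - x) M x := by
  have hsq : HasFDerivWithinAt (fun y : E => ‖y‖ ^ 2 / 2) (InnerProductSpace.toDual ℝ E x) M x := by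
    have h := ((hasStrictFDerivAt_norm_sq x).hasFDerivAt.hasFDerivWithinAt (s := M)).const_mul
      (2⁻¹ : ℝ)
    refine (h.congr_fderiv ?_).congr (fun y _ => by ring) (by ring)
    ext w
    simp
  simp only [hasGradientWithinAt_iff_hasFDerivWithinAt]
  constructor
  · intro h
    rw [map_sub]
    exact (h.sub hsq).congr (fun y _ => by simp) (by simp)
  · intro h
    rw [map_sub] at h
    exact ((h.add hsq).congr_fderiv (sub_add_cancel _ _))

end Gradient

/-! ### Brenier's theorem and Fenchel equality for gradients -/

section Transport

variable {E : Type*} [NormedAddCommGroup E] [InnerProductSpace ℝ E] [FiniteDimensional ℝ E]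
  [MeasurableSpace E] [BorelSpace E] {M : Set E} {m μ : Measure E}

/-- Brenier's theorem on a compact set. -/
theorem exists_legendre_potentials {ρ : Measure E} [ρ.IsAddHaarMeasure] [IsProbabilityMeasure m]
    [IsProbabilityMeasure μ] (hMc : IsCompact M) (hac : m ≪ ρ) (hm : m Mᶜ = 0) (hμ : μ Mᶜ = 0) :
    ∃ a b c : E → ℝ, IsLegendreConjugate M a b ∧ IsLegendreConjugate M b c ∧
      m.map (gradient b) = μ ∧ (∀ᵐ x ∂m, DifferentiableAt ℝ b x) ∧
      ∀ᵐ x ∂m, DifferentiableAt ℝ c x := by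
  have : CompactSpace M := isCompact_iff_compactSpace.1 hMc
  have hμM : ∀ᵐ y ∂μ, y ∈ range (Subtype.val : M → E) := by
    rw [Subtype.range_val]
    exact mem_ae_iff.2 hμ
  have hemb : MeasurableEmbedding (Subtype.val : M → E) :=
    MeasurableEmbedding.subtype_coe hMc.measurableSet
  have hmap : (μ.comap (Subtype.val : M → E)).map Subtype.val = μ := by
    rw [hemb.map_comap, Measure.restrict_eq_self_of_ae_mem hμM]
  have : IsProbabilityMeasure (μ.comap (Subtype.val : M → E)) := hemb.isProbabilityMeasure_comap hμM
  have : Nonempty M := (μ.comap (Subtype.val : M → E)).nonempty_of_neZero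
  obtain ⟨a, ha⟩ := exists_dualObjective_minimizer (κ := μ.comap (Subtype.val : M → E)) hm
  -- The extension of `a` by `0` below is harmless: only its values on `M` enter the conjugacy.
  have hb : Continuous (legendre M a) := continuous_legendre a.continuous
  refine ⟨Function.extend Subtype.val a 0, legendre M a, legendre M fun y => legendre M a y,
    ?_, isLegendreConjugate_legendre hb.continuousOn, ?_,
    ae_differentiableAt_legendre hac a.continuous,
    ae_differentiableAt_legendre hac (hb.comp continuous_subtype_val)⟩
  · have hext : (fun y : M => Function.extend Subtype.val a 0 (y : E)) = a :=
      funext fun y => Subtype.val_injective.extend_apply a 0 y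
    have hcont : ContinuousOn (Function.extend Subtype.val a 0) M := by
      rw [continuousOn_iff_continuous_domRestrict]
      exact a.continuous.congr fun y => (congrFun hext y).symm
    simpa only [hext] using isLegendreConjugate_legendre hcont
  · rw [map_gradient_legendre_of_minimizer hac hm ha, hmap]

/-- Optimal maps must send all of `M` into `M`, whereas a gradient does so only almost everywhere;
it is reset to `z` where it leaves `M`. -/
theorem exists_mapsTo_fenchel_eq [IsProbabilityMeasure m] (hMc : IsCompact M) (hM : Convex ℝ M)
    (hm : m Mᶜ = 0) {z : E} (hz : z ∈ M) {a b c : E → ℝ} (hab : IsLegendreConjugate M a b)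
    (hbc : IsLegendreConjugate M b c) {g : E → E} (hg : Measurable g) (hgM : m.map g Mᶜ = 0)
    (hgrad : ∀ᵐ x ∂m, HasGradientWithinAt b (g x) M x) :
    ∃ g', Measurable g' ∧ MapsTo g' M M ∧ g' =ᵐ[m] g ∧
      ∀ᵐ x ∂m, b x + c (g' x) = inner ℝ x (g' x) := by
  classical
  have : CompleteSpace E := FiniteDimensional.complete ℝ E
  have hpre : MeasurableSet (g ⁻¹' M) := hg hMc.measurableSet
  have hmem : ∀ᵐ x ∂m, g x ∈ M := ae_of_ae_map hg.aemeasurable (mem_ae_iff.2 hgM)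
  have heq : (g ⁻¹' M).piecewise g (fun _ => z) =ᵐ[m] g := by
    filter_upwards [hmem] with x hx
    exact piecewise_eq_of_mem _ _ _ hx
  refine ⟨_, hg.piecewise hpre measurable_const, fun x _ => ?_, heq, ?_⟩
  · by_cases hx : x ∈ g ⁻¹' M
    · rw [piecewise_eq_of_mem _ _ _ hx]; exact hx
    · rw [piecewise_eq_of_notMem _ _ _ hx]; exact hz
  · filter_upwards [heq, hmem, hgrad, mem_ae_iff.2 hm] with x hx hgx hd hxM
    rw [hx]
    exact hbc.eq_of_subgradient hxM hgx fun w hw =>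
      (hab.convexOn hM).add_inner_le_of_hasGradientWithinAt hxM hd hw

end Transport

/-! ### The contact set of the atom and the conclusion -/

theorem lemma4p1 {n : ℕ} (hn : 1 ≤ n)
    (M : Set (EuclideanSpace ℝ (Fin n))) (hMc : IsCompact M) (hMconv : Convex ℝ M)
    (m : Measure (EuclideanSpace ℝ (Fin n))) [IsProbabilityMeasure m]
    (hac : m ≪ volume) (hsupp : m.support = M)
    (lam : ℝ) (hlam : lam ∈ Set.Icc (0 : ℝ) 1)
    (z : EuclideanSpace ℝ (Fin n)) (hz : z ∈ M)
    (ν : Measure (EuclideanSpace ℝ (Fin n))) [IsProbabilityMeasure ν] (hν : ν Mᶜ = 0)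
    (μ : Measure (EuclideanSpace ℝ (Fin n)))
    (hμ : μ = ENNReal.ofReal lam • Measure.dirac z + ENNReal.ofReal (1 - lam) • ν) :
    (∃ g, IsOptimalTransportMap M m g ∧ m.map g = μ) ∧
    (∃ μc, IsConjugateMeasure M m μ μc) ∧
    ∃ U : Set (EuclideanSpace ℝ (Fin n)),
      IsOpen U ∧ Convex ℝ U ∧ U ⊆ M ∧ m U = ENNReal.ofReal lam ∧
      (∀ g, IsOptimalTransportMap M m g → m.map g = μ → ∀ᵐ x ∂(m.restrict U), g x = z) ∧
      (∀ μc, IsConjugateMeasure M m μ μc → μc U = 0) := by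
  have : Nonempty (Fin n) := ⟨⟨0, hn⟩⟩
  have hm : m Mᶜ = 0 := hsupp ▸ Measure.measure_compl_support
  have hMm : MeasurableSet M := hMc.measurableSet
  have hμM : μ Mᶜ = 0 := by
    simp [hμ, hν, Measure.dirac_apply' z hMm.compl, hz]
  have : IsProbabilityMeasure μ := ⟨by
    simp only [hμ, Measure.coe_add, Measure.coe_smul, Pi.add_apply, Pi.smul_apply, measure_univ,
      smul_eq_mul, mul_one]
    rw [← ENNReal.ofReal_add hlam.1 (sub_nonneg.2 hlam.2)]
    simp⟩
  have hμz : ENNReal.ofReal lam ≤ μ {z} := by simp [hμ]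
  obtain ⟨a, b, c, hab, hbc, hmap, hdb, hdc⟩ := exists_legendre_potentials hMc hac hm hμM
  have hcb := hab.biconjugate hbc
  have hgradb : ∀ᵐ x ∂m, HasGradientWithinAt b (gradient b x) M x :=
    hdb.mono fun x hx => hx.hasGradientAt.hasFDerivAt.hasFDerivWithinAt
  have hgradc : ∀ᵐ x ∂m, HasGradientWithinAt c (gradient c x) M x :=
    hdc.mono fun x hx => hx.hasGradientAt.hasFDerivAt.hasFDerivWithinAt
  obtain ⟨T, hT, hTM, hTae, hTeq⟩ := exists_mapsTo_fenchel_eq hMc hMconv hm hz hab hbc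
    (measurable_gradient b) (hmap ▸ hμM) hgradb
  have hTmap : m.map T = μ := (Measure.map_congr hTae).trans hmap
  refine ⟨⟨T, isOptimalTransportMap_of_fenchel_eq hMc hm hcb hbc hT hTM hTeq, hTmap⟩, ?_, ?_⟩
  · refine ⟨m.map (gradient c), fun x => b x - ‖x‖ ^ 2 / 2, fun x => c x - ‖x‖ ^ 2 / 2,
      gradient b, gradient c, ⟨fun x => a x - ‖x‖ ^ 2 / 2, ?_⟩, ?_, measurable_gradient b, ?_, hmap,
      measurable_gradient c, ?_, rfl⟩
    · simpa [isConjugateFunction_iff_isLegendreConjugate] using hab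
    · simpa [isConjugateFunction_iff_isLegendreConjugate] using hbc
    · filter_upwards [hgradb] with x hx
      simpa [← hasGradientWithinAt_add_norm_sq_div_two_iff] using hx
    · filter_upwards [hgradc] with x hx
      simpa [← hasGradientWithinAt_add_norm_sq_div_two_iff] using hx
  set C := {x | x ∈ M ∧ ∀ w ∈ M, b x + inner ℝ z (w - x) ≤ b w} with hC
  have hCconv : Convex ℝ C := convex_setOf_subgradient hMconv (hab.convexOn hMconv) z
  have hCm : ENNReal.ofReal lam ≤ m C := by
    refine hμz.trans ?_
    rw [← hTmap, Measure.map_apply hT (measurableSet_singleton z)]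
    refine measure_mono_ae ?_
    filter_upwards [hTeq, mem_ae_iff.2 hm] with x hx hxM hxz
    have hxz : T x = z := hxz
    rw [hxz] at hx
    exact ⟨hxM, fun w hw => hcb.add_inner_le_of_eq hz hx hw⟩
  obtain ⟨U, hUo, hUconv, hUC, hUm⟩ := hCconv.exists_isOpen_convex_measure_eq hac
    (hMc.isBounded.subset fun x hx => hx.1) hlam.1 hCm
  have hUM : U ⊆ M := fun x hx => (hUC hx).1
  have hopt : ∀ g, IsOptimalTransportMap M m g → m.map g = μ →
      ∀ᵐ x ∂(m.restrict U), g x = z := by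
    intro g hg hgmap
    have hgeq := hg.fenchel_eq hMc hm hcb hbc hT hTM hTeq (hgmap.trans hTmap.symm)
    rw [ae_restrict_iff' hUo.measurableSet]
    filter_upwards [hgeq] with x hx hxU
    -- Monotonicity between `x`, with subgradient `g x`, and `w`, with subgradient `z`.
    refine sub_eq_zero.1 (eq_zero_of_inner_sub_nonpos hUo hxU fun w hw => ?_)
    have h₁ := hcb.add_inner_le_of_eq (hg.2.1 (hUM hxU)) hx (hUM hw)
    have h₂ := (hUC hw).2 x (hUM hxU)
    rw [← neg_sub w x, inner_neg_right] at h₂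
    rw [inner_sub_left]
    linarith
  refine ⟨U, hUo, hUconv, hUM, hUm, hopt, ?_⟩
  rintro μc ⟨φ, φc, g, gc, ⟨ψ, hψφ⟩, hφφc, hg, hgφ, hgmap, hgc, hgcφ, rfl⟩
  rw [isConjugateFunction_iff_isLegendreConjugate] at hψφ hφφc
  have hφcφ := hψφ.biconjugate hφφc
  have hgrad := hgφ.mono fun x hx => hasGradientWithinAt_add_norm_sq_div_two_iff.2 hx
  have hgradc := hgcφ.mono fun x hx => hasGradientWithinAt_add_norm_sq_div_two_iff.2 hx
  -- The potentials `b'`, `c'` need not be `b`, `c`. Their transport map `S` is still optimal with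
  -- image `μ`, so it equals `z` almost everywhere on the same `U`.
  generalize (fun x => φ x + ‖x‖ ^ 2 / 2) = b' at *
  generalize (fun x => φc x + ‖x‖ ^ 2 / 2) = c' at *
  obtain ⟨S, hS, hSM, hSae, hSeq⟩ := exists_mapsTo_fenchel_eq hMc hMconv hm hz hψφ hφφc hg
    (hgmap ▸ hμM) hgrad
  have hSz := hopt S (isOptimalTransportMap_of_fenchel_eq hMc hm hφcφ hφφc hS hSM hSeq)
    ((Measure.map_congr hSae).trans hgmap)
  rw [ae_restrict_iff' hUo.measurableSet] at hSz
  rw [Measure.map_apply hgc hUo.measurableSet]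
  have hne : ∀ᵐ x ∂m, x ≠ z := compl_mem_ae_iff.2 (hac (measure_singleton z))
  refine compl_mem_ae_iff.1 ?_
  filter_upwards [hgradc, mem_ae_iff.2 hm, hne] with x hx hxM hxz hxU
  have hyU : gc x ∈ U := hxU
  have hy : c' x + b' (gc x) = inner ℝ x (gc x) := hφcφ.eq_of_subgradient hxM (hUM hyU)
    fun w hw => (hφφc.convexOn hMconv).add_inner_le_of_hasGradientWithinAt hxM hx hw
  have hxsub : ∀ w ∈ M, b' (gc x) + inner ℝ x (w - gc x) ≤ b' w := fun w hw =>
    hφcφ.add_inner_le_of_eq hxM (by rw [real_inner_comm]; linarith) hw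
  refine hxz (sub_eq_zero.1 (eq_zero_of_inner_sub_nonpos hUo hyU fun w hw => ?_))
  -- Here `z` is known to be a subgradient of `b'` only almost everywhere on `U`. Monotonicity
  -- against `x` at `gc x` makes `V` null, while `V` is an open neighbourhood of `w`, a point of the
  -- support.
  by_contra! hpos
  set V := U ∩ {v | 0 < inner ℝ (x - z) (v - gc x)} with hV
  have hVo : IsOpen V := hUo.inter (isOpen_lt continuous_const (by fun_prop))
  have hwsupp : w ∈ m.support := hsupp ▸ hUM hw
  have hVpos := Measure.mem_support_iff_forall w |>.1 hwsupp V (hVo.mem_nhds ⟨hw, hpos⟩)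
  refine hVpos.ne' (compl_mem_ae_iff.1 ?_)
  filter_upwards [hSz, hSeq] with v hv hveq hvV
  rw [hv hvV.1] at hveq
  have h₁ := hφcφ.add_inner_le_of_eq hz hveq (hUM hyU)
  have h₂ := hxsub v (hUM hvV.1)
  have h₃ : 0 < inner ℝ (x - z) (v - gc x) := hvV.2
  rw [← neg_sub v (gc x), inner_neg_right] at h₁
  rw [inner_sub_left] at h₃
  linarith
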